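/- For an integer $m\ge 0$ let $\gamma_m(\zeta)=(\pi\, m!)^{-1/2}\,\bar\zeta^{\,m}e^{-|\zeta|^2/2}$ $(\zeta\in\mathbb C)$ be the Landau state of angular momentum $-m$ at unit field strength, and put $$V_m(x)=\int_{\mathbb C}\frac{|\gamma_m(\zeta)|^2}{\sqrt{x^2+|\zeta|^2}}\,d^2\zeta,\qquad W_{m,m}(u)=\int_{\mathbb C}\int_{\mathbb C}\frac{|\gamma_m(\zeta)|^2|\gamma_m(\zeta')|^2}{\sqrt{u^2+|\zeta-\zeta'|^2}}\,d^2\zeta\,d^2\zeta' .$$ For real $Z>0$, $M>0$ and integers $N\ge 0$ the $m$-momentum Landau model is the Hamiltonian on $L^2(\mathbb R^N)$ $$h^m(N,Z,M)=\sum_{j=1}^N\Big[-\frac1M\frac{d^2}{dx_j^2}-Z\,V_m(x_j)\Big]+\sum_{1\le j<k\le N}W(|x_j-x_k|),\qquad W=W_{m,m}.$$ For $B>0$ let $E_0(N,Z,B)=\inf\langle\Phi,h^m(N,Z,B^{-1/2})\Phi\rangle$, the infimum being over $\Phi\in C_c^\infty(\mathbb R^N;\mathbb C)$ with $\|\Phi\|_{L^2}=1$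 (so $E_0(0,Z,B)=0$), and let $N_{\max}(Z,B)$ be the supremum (in $[-\infty,\infty]$) of the integers $N\ge1$ with $E_0(N,Z,B)<E_0(N-1,Z,B)$. Fix $m$. All constants below may depend on $m$. (i) There are constants $a_1,a_2>0$ such that for every $\alpha>0$ there is a constant $A_\alpha>0$ with the following property: for all $\varepsilon>0$, all real $Z\ge1$ and all $B$ with $a_1e^{Z^{\alpha/4}}>B\ge a_2Z^{2+\varepsilon}$, $$N_{\max}(Z,B)\le 2Z+A_\alpha Z^{1+\alpha}.$$ (ii) For every $a>0$ and $p>3$ there is a constant $A>0$ (depending on $a$ and $p$) such that for all real $Z\ge2$, with $B=aZ^p$, $$N_{\max}(Z,B)\le 3Z+A\,Z(\log Z)^2 .$$ Both statements also hold, with possibly different constants, for the model in which $W$ is instead $W(u)=\frac1{\sqrt2}V_{2m}\big(\frac{u}{\sqrt2}\big)$. -/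

import Mathlib

open MeasureTheory Filter Topology
open scoped ContDiff ComplexConjugate

noncomputable section

namespace LandauModel

/-- The lowest-band Landau state of angular momentum `-m` at field strength one, in the complex
coordinate `ζ` of the plane orthogonal to the field:
`γ_m(ζ) = (π m!)^{-1/2} (conj ζ)^m exp(-|ζ|²/2)`. -/
def landauState (m : ℕ) (ζ : ℂ) : ℂ :=
  (((Real.sqrt (Real.pi * (m.factorial : ℝ)))⁻¹ : ℝ) : ℂ) * (conj ζ) ^ m
    * ((Real.exp (-‖ζ‖ ^ 2 / 2) : ℝ) : ℂ)

/-- The regularized Coulomb potential `V_m(x) = ⟨γ_m, |r|⁻¹ γ_m⟩`, where `r = (x, ζ)`. -/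
def V (m : ℕ) (x : ℝ) : ℝ :=
  ∫ ζ : ℂ, ‖landauState m ζ‖ ^ 2 / Real.sqrt (x ^ 2 + ‖ζ‖ ^ 2)

/-- The effective interaction
`W_{m,m'}(x - x') = ⟨γ_m ⊗ γ_{m'}, |r - r'|⁻¹ γ_m ⊗ γ_{m'}⟩` as a function of `u = x - x'`. -/
def W (m m' : ℕ) (u : ℝ) : ℝ :=
  ∫ p : ℂ × ℂ, ‖landauState m p.1‖ ^ 2 * ‖landauState m' p.2‖ ^ 2
    / Real.sqrt (u ^ 2 + ‖p.1 - p.2‖ ^ 2)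

/-- The interaction `u ↦ 2^{-1/2} V_{2m}(u / √2)`, a pointwise lower bound of `W m m`. -/
def WLower (m : ℕ) (u : ℝ) : ℝ :=
  (Real.sqrt 2)⁻¹ * V (2 * m) (u / Real.sqrt 2)

/-- The second partial derivative `∂²Φ/∂x_j²`. -/
def secondPartial {N : ℕ} (j : Fin N) (Φ : (Fin N → ℝ) → ℂ) (x : Fin N → ℝ) : ℂ :=
  iteratedDeriv 2 (fun t : ℝ => Φ (Function.update x j t)) (x j)

/-- The `N`-electron Hamiltonian
`h = ∑_j [-(1/M) d²/dx_j² - Z v(x_j)] + ∑_{j<k} w(|x_j - x_k|)`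
with one-body potential `v`, interaction `w`, nuclear charge `Z` and mass `M`. -/
def hamiltonian (v w : ℝ → ℝ) (N : ℕ) (Z M : ℝ) (Φ : (Fin N → ℝ) → ℂ) (x : Fin N → ℝ) : ℂ :=
  (∑ j : Fin N, (-((1 / M : ℝ) : ℂ) * secondPartial j Φ x - ((Z * v (x j) : ℝ) : ℂ) * Φ x))
    + ∑ j : Fin N, ∑ k ∈ Finset.Ioi j, ((w |x j - x k| : ℝ) : ℂ) * Φ x

/-- Normalized wave functions in `C_c^∞(ℝ^N)`. For bounded potentials this space is a core of the
self-adjoint realization of the Hamiltonian, so the infimum below is the bottom of the spectrum. -/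
structure IsTrial {N : ℕ} (Φ : (Fin N → ℝ) → ℂ) : Prop where
  smooth : ContDiff ℝ ∞ Φ
  compactSupport : HasCompactSupport Φ
  normalized : ∫ x, ‖Φ x‖ ^ 2 = 1

/-- The ground-state energy `inf_{‖Φ‖ = 1} ⟨Φ, h(N, Z, M) Φ⟩`. -/
def groundEnergy (v w : ℝ → ℝ) (N : ℕ) (Z M : ℝ) : EReal :=
  ⨅ (Φ : (Fin N → ℝ) → ℂ) (_ : IsTrial Φ),
    (((∫ x, conj (Φ x) * hamiltonian v w N Z M Φ x).re : ℝ) : EReal)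

/-- `h(N, Z, B^{-1/2})` has a bound state, in the sense `E₀(N, Z, B) < E₀(N - 1, Z, B)`. -/
def HasBoundState (v w : ℝ → ℝ) (N : ℕ) (Z B : ℝ) : Prop :=
  1 ≤ N ∧ groundEnergy v w N Z (B ^ (-(1 / 2) : ℝ)) < groundEnergy v w (N - 1) Z (B ^ (-(1 / 2) : ℝ))

/-- The maximal number of electrons that can be bound, `N_max(Z, B)`; it is `⊤` if there is no
maximum. -/
def Nmax (v w : ℝ → ℝ) (Z B : ℝ) : EReal :=
  ⨆ (N : ℕ) (_ : HasBoundState v w N Z B), ((N : ℝ) : EReal)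

end LandauModel

end

/-! Both parts follow from one bound, `N_max ≤ 1 + C Z (1 + log² (1 + √B / Z))` (`exists_Nmax_le`):
the logarithm is `O(Z^(α/4))` in the first regime and `O(log Z)` in the second.

That bound comes from `groundEnergy_le_succ`: once `n` exceeds a multiple of `Z (1 + log² (1 + L))`,
with `L = √B / Z`, an extra electron cannot lower the energy. The method is Lieb's multiplication by
a weight. Put `R = 1 + L`, `g(x) = √(R² + x²)`, `G = ∑ g(x_k)`, and write a trial function as `Φ =
√G ψ`. For each `k`, the part of the energy weighted by `g(x_k)` that does not involve electron `k`
is, slice by slice in `x_k`, an `n`-electron energy. What remains is the kinetic energy and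
attraction of electron `k`, and its repulsion from the others.

The interaction is at least `c / (1 + |u|)` and `g(x) + g(y) ≥ (1 + |x - y|) / 2`, so the weighted
repulsion is at least `n (n + 1) c / 4` times `|ψ|²`. The weighted attraction `g V` may be as large
as `R`, but up to a bounded term it lies below `C R` times the derivative of `arsinhDiff R`, a
function bounded by `log R`. Subtracting a total derivative turns this into a cross term in `ψ` and
`∂ψ`, which the kinetic energy `Z L g |∂ψ|²` absorbs at a cost of order `Z (1 + log² R)`
(`one_body_le`). The pointwise balance is `energyDensity_ge`. -/

noncomputable section

namespace LandauModel

/-! ### Bounds for the one-body potential and the interaction -/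

/-- The position density of the Landau state. -/
def density (m : ℕ) (ζ : ℂ) : ℝ := ‖landauState m ζ‖ ^ 2

lemma density_eq (m : ℕ) (ζ : ℂ) :
    density m ζ = (Real.pi * m.factorial)⁻¹ * (‖ζ‖ ^ (2 * m) * Real.exp (-‖ζ‖ ^ 2)) := by
  have h : 0 ≤ Real.pi * (m.factorial : ℝ) := by positivity
  simp only [density, landauState, norm_mul, norm_pow, Complex.norm_real, RCLike.norm_conj,
    norm_inv, Real.norm_eq_abs, abs_of_nonneg (Real.sqrt_nonneg _), Real.abs_exp]
  rw [mul_pow, mul_pow, inv_pow, Real.sq_sqrt h, ← Real.exp_nat_mul, ← pow_mul, mul_comm m 2,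
    mul_assoc]
  congr 3
  push_cast
  ring

lemma density_nonneg (m : ℕ) (ζ : ℂ) : 0 ≤ density m ζ := by
  unfold density; positivity

@[fun_prop]
lemma continuous_density (m : ℕ) : Continuous (density m) := by
  rw [funext (density_eq m)]
  fun_prop

lemma density_le_one (m : ℕ) (ζ : ℂ) : density m ζ ≤ 1 := by
  have h1 := Real.pow_div_factorial_le_exp (‖ζ‖ ^ 2) (by positivity) m
  have hm : (0 : ℝ) < m.factorial := by positivity
  have h2 : ‖ζ‖ ^ (2 * m) * Real.exp (-‖ζ‖ ^ 2) ≤ m.factorial := by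
    rw [Real.exp_neg, ← div_eq_mul_inv, div_le_iff₀ (Real.exp_pos _), pow_mul]
    rw [div_le_iff₀ hm] at h1
    linarith
  rw [density_eq, inv_mul_le_iff₀ (by positivity), mul_one]
  have := Real.pi_gt_three
  nlinarith

lemma integrable_norm_rpow_mul_exp {q : ℝ} (hq : -2 < q) :
    Integrable fun ζ : ℂ => ‖ζ‖ ^ q * Real.exp (-‖ζ‖ ^ 2) := by
  have h := Complex.integral_rpow_mul_exp_neg_rpow (p := 2) (by norm_num) hq
  have hpos : 0 < (2 * Real.pi / 2) * Real.Gamma ((q + 2) / 2) :=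
    mul_pos (by positivity) (Real.Gamma_pos_of_pos (by linarith))
  -- The integral of a nonintegrable function is 0 by convention, so the positive Gamma value forces
  -- integrability.
  have h2 := not_imp_comm.1 (integral_undef (μ := (volume : Measure ℂ))
    (f := fun ζ : ℂ => ‖ζ‖ ^ q * Real.exp (-‖ζ‖ ^ (2 : ℝ)))) (by rw [h]; exact hpos.ne')
  simpa using h2

lemma integrable_density (m : ℕ) : Integrable (density m) := by
  have h := (integrable_norm_rpow_mul_exp (q := ((2 * m : ℕ) : ℝ)) (by
    have : (0 : ℝ) ≤ ((2 * m : ℕ) : ℝ) := Nat.cast_nonneg _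
    linarith)).const_mul (Real.pi * m.factorial)⁻¹
  simp only [Real.rpow_natCast] at h
  rwa [← funext (density_eq m)] at h

lemma integrable_density_div_norm (m : ℕ) : Integrable fun ζ => density m ζ / ‖ζ‖ := by
  have h := (integrable_norm_rpow_mul_exp (q := ((2 * m : ℕ) : ℝ) - 1) (by
    have : (0 : ℝ) ≤ ((2 * m : ℕ) : ℝ) := Nat.cast_nonneg _
    linarith)).const_mul (Real.pi * m.factorial)⁻¹
  refine h.congr ?_
  filter_upwards [Measure.ae_ne volume (0 : ℂ)] with ζ hζ
  rw [Real.rpow_sub_one (norm_ne_zero_iff.2 hζ), Real.rpow_natCast, density_eq]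
  ring

lemma one_div_sqrt_le (a : ℝ) {r : ℝ} (hr : 0 < r) : 1 / √(a ^ 2 + r ^ 2) ≤ 1 / r :=
  one_div_le_one_div_of_le hr (Real.le_sqrt_of_sq_le (by nlinarith [sq_nonneg a]))

/-- Separates the variables: decay in `a` times the factor `1 + 1 / r`, which is integrable against
the planar density. -/
lemma one_div_sqrt_le_div_sqrt (a : ℝ) {r : ℝ} (hr : 0 < r) :
    1 / √(a ^ 2 + r ^ 2) ≤ (1 + 1 / r) / √(1 + a ^ 2) := by
  rw [div_le_div_iff₀ (by positivity) (by positivity), one_mul]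
  have h : √(1 + a ^ 2) ≤ √((1 + 1 / r) ^ 2 * (a ^ 2 + r ^ 2)) := by
    apply Real.sqrt_le_sqrt
    have h1 : (1 + 1 / r) ^ 2 * (a ^ 2 + r ^ 2)
        = 1 + a ^ 2 + (a ^ 2 * (2 / r + (1 / r) ^ 2) + 2 * r + r ^ 2) := by field_simp; ring
    rw [h1]
    have : 0 ≤ a ^ 2 * (2 / r + (1 / r) ^ 2) + 2 * r + r ^ 2 := by positivity
    linarith
  rwa [Real.sqrt_mul (by positivity), Real.sqrt_sq (by positivity)] at h

/-- The freedom in `s ≥ r` lets `1 + s` be a product of one-particle factors when `r = ‖ζ - ζ'‖`, so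
that the double integral factorizes. -/
lemma le_one_div_sqrt (a : ℝ) {r s : ℝ} (hr : 0 < r) (hs : r ≤ s) :
    1 / ((1 + |a|) * (1 + s)) ≤ 1 / √(a ^ 2 + r ^ 2) := by
  have hs0 : 0 < s := hr.trans_le hs
  apply one_div_le_one_div_of_le (by positivity)
  rw [Real.sqrt_le_left (by positivity)]
  have h1 : |a| ^ 2 + r ^ 2 ≤ (|a| + r) ^ 2 := by nlinarith [abs_nonneg a]
  have h2 : |a| + r ≤ (1 + |a|) * (1 + s) := by nlinarith [abs_nonneg a]
  rw [← sq_abs a]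
  exact h1.trans (by gcongr)

lemma ae_norm_pos : ∀ᵐ ζ : ℂ, 0 < ‖ζ‖ := by
  filter_upwards [Measure.ae_ne volume (0 : ℂ)] with ζ hζ using norm_pos_iff.2 hζ

lemma ae_norm_sub_pos : ∀ᵐ p : ℂ × ℂ, 0 < ‖p.1 - p.2‖ :=
  (quasiMeasurePreserving_sub (volume : Measure ℂ) volume).ae ae_norm_pos

lemma measurable_V (m : ℕ) : Measurable (V m) := by
  have h : StronglyMeasurable fun p : ℝ × ℂ => density m p.2 / √(p.1 ^ 2 + ‖p.2‖ ^ 2) := by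
    apply Measurable.stronglyMeasurable
    fun_prop
  exact (h.integral_prod_right (ν := volume)).measurable

lemma measurable_W (m m' : ℕ) : Measurable (W m m') := by
  have h : StronglyMeasurable fun p : ℝ × (ℂ × ℂ) =>
      density m p.2.1 * density m' p.2.2 / √(p.1 ^ 2 + ‖p.2.1 - p.2.2‖ ^ 2) := by
    apply Measurable.stronglyMeasurable
    fun_prop
  exact (h.integral_prod_right (ν := volume)).measurable

lemma V_nonneg (m : ℕ) (x : ℝ) : 0 ≤ V m x :=
  integral_nonneg fun _ => by positivity

lemma W_nonneg (m m' : ℕ) (u : ℝ) : 0 ≤ W m m' u :=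
  integral_nonneg fun _ => by positivity

lemma integrable_V_integrand (m : ℕ) (x : ℝ) :
    Integrable fun ζ => density m ζ / √(x ^ 2 + ‖ζ‖ ^ 2) := by
  refine (integrable_density_div_norm m).mono' (Measurable.aestronglyMeasurable (by fun_prop)) ?_
  filter_upwards [ae_norm_pos] with ζ hζ
  have h0 := density_nonneg m ζ
  rw [Real.norm_of_nonneg (by positivity), div_eq_mul_one_div, div_eq_mul_one_div _ ‖ζ‖]
  exact mul_le_mul_of_nonneg_left (one_div_sqrt_le x hζ) h0

lemma exists_V_le (m : ℕ) : ∃ C : ℝ, 0 < C ∧ ∀ x, V m x ≤ C / √(1 + x ^ 2) := by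
  have hI : Integrable fun ζ => density m ζ + density m ζ / ‖ζ‖ :=
    (integrable_density m).add (integrable_density_div_norm m)
  have h0 : 0 ≤ ∫ ζ, (density m ζ + density m ζ / ‖ζ‖) := integral_nonneg fun ζ => by
    have := density_nonneg m ζ
    positivity
  refine ⟨(∫ ζ, (density m ζ + density m ζ / ‖ζ‖)) + 1, by linarith, fun x => ?_⟩
  have h : V m x ≤ ∫ ζ, (density m ζ + density m ζ / ‖ζ‖) / √(1 + x ^ 2) := by
    refine integral_mono_ae (integrable_V_integrand m x) (hI.div_const _) ?_
    filter_upwards [ae_norm_pos] with ζ hζ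
    have h := mul_le_mul_of_nonneg_left (one_div_sqrt_le_div_sqrt x hζ) (density_nonneg m ζ)
    calc _ = density m ζ * (1 / √(x ^ 2 + ‖ζ‖ ^ 2)) := div_eq_mul_one_div _ _
      _ ≤ _ := h
      _ = _ := by ring
  rw [integral_div] at h
  exact h.trans (by gcongr; linarith)

lemma integrable_density_div_one_add_norm (m : ℕ) :
    Integrable fun ζ => density m ζ / (1 + ‖ζ‖) := by
  refine (integrable_density m).mono' (Measurable.aestronglyMeasurable (by fun_prop)) ?_
  refine ae_of_all _ fun ζ => ?_
  have h0 := density_nonneg m ζ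
  rw [Real.norm_of_nonneg (by positivity)]
  exact div_le_self h0 (by linarith [norm_nonneg ζ])

lemma integral_density_div_one_add_norm_pos (m : ℕ) : 0 < ∫ ζ, density m ζ / (1 + ‖ζ‖) := by
  have h0 : ∀ ζ, 0 ≤ density m ζ / (1 + ‖ζ‖) := fun ζ => by
    have := density_nonneg m ζ
    positivity
  have hc : Continuous fun ζ => density m ζ / (1 + ‖ζ‖) :=
    (continuous_density m).div (by fun_prop) fun ζ => by positivity
  -- The density vanishes at 0 when `m > 0`, so positivity is tested at 1.
  refine integral_pos_of_integrable_nonneg_nonzero (x := 1) hc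
    (integrable_density_div_one_add_norm m) h0 ?_
  rw [density_eq]
  simp
  exact Nat.factorial_ne_zero m

lemma exists_le_V (m : ℕ) : ∃ c : ℝ, 0 < c ∧ ∀ x, c / (1 + |x|) ≤ V m x := by
  refine ⟨_, integral_density_div_one_add_norm_pos m, fun x => ?_⟩
  rw [← integral_div]
  refine integral_mono_ae ((integrable_density_div_one_add_norm m).div_const _)
    (integrable_V_integrand m x) ?_
  filter_upwards [ae_norm_pos] with ζ hζ
  have h := mul_le_mul_of_nonneg_left (le_one_div_sqrt x hζ le_rfl) (density_nonneg m ζ)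
  calc _ = density m ζ * (1 / ((1 + |x|) * (1 + ‖ζ‖))) := by field_simp
    _ ≤ _ := h
    _ = _ := (div_eq_mul_one_div _ _).symm

/-- Near `z = 0` the density is replaced by its bound 1, leaving an integrable function of `z`
alone; with `z = ζ - ζ'` the double integral is then dominated by a convolution integrand. -/
lemma density_div_norm_sub_le (m : ℕ) (ζ z : ℂ) (hz : 0 < ‖z‖) :
    density m ζ / ‖z‖ ≤ density m ζ + Real.exp 1 * (‖z‖ ^ (-1 : ℝ) * Real.exp (-‖z‖ ^ 2)) := by
  have h0 := density_nonneg m ζ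
  rw [Real.rpow_neg_one]
  rcases le_total 1 ‖z‖ with h | h
  · have := div_le_self h0 h
    have : 0 ≤ Real.exp 1 * (‖z‖⁻¹ * Real.exp (-‖z‖ ^ 2)) := by positivity
    linarith
  · have h1 : 1 ≤ Real.exp 1 * Real.exp (-‖z‖ ^ 2) := by
      rw [← Real.exp_add]
      exact Real.one_le_exp (by nlinarith)
    have h2 : density m ζ / ‖z‖ ≤ Real.exp 1 * (‖z‖⁻¹ * Real.exp (-‖z‖ ^ 2)) := by
      rw [div_eq_mul_inv, mul_left_comm, mul_comm]
      gcongr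
      exact (density_le_one m ζ).trans h1
    linarith

lemma integrable_density_mul_div_norm_sub (m m' : ℕ) :
    Integrable fun p : ℂ × ℂ => density m p.1 * density m' p.2 / ‖p.1 - p.2‖ := by
  have h1 := (integrable_density m).mul_prod (integrable_density m')
  have h2 := (integrable_density m').convolution_integrand (ContinuousLinearMap.mul ℝ ℝ)
    ((integrable_norm_rpow_mul_exp (q := -1) (by norm_num)).const_mul (Real.exp 1))
  refine (h1.add h2).mono' (Measurable.aestronglyMeasurable (by fun_prop)) ?_
  filter_upwards [ae_norm_sub_pos] with p hp
  have h0 := density_nonneg m p.1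
  have h0' := density_nonneg m' p.2
  have h := mul_le_mul_of_nonneg_left (density_div_norm_sub_le m p.1 (p.1 - p.2) hp) h0'
  rw [Real.norm_of_nonneg (by positivity)]
  calc _ = density m' p.2 * (density m p.1 / ‖p.1 - p.2‖) := by ring
    _ ≤ _ := h
    _ = _ := by
      simp only [Pi.add_apply, ContinuousLinearMap.mul_apply']
      ring

lemma W_integrand_le (m m' : ℕ) (u : ℝ) : ∀ᵐ p : ℂ × ℂ,
    density m p.1 * density m' p.2 / √(u ^ 2 + ‖p.1 - p.2‖ ^ 2)
      ≤ density m p.1 * density m' p.2 / ‖p.1 - p.2‖ := by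
  filter_upwards [ae_norm_sub_pos] with p hp
  rw [div_eq_mul_one_div, div_eq_mul_one_div _ ‖p.1 - p.2‖]
  exact mul_le_mul_of_nonneg_left (one_div_sqrt_le u hp)
    (mul_nonneg (density_nonneg m p.1) (density_nonneg m' p.2))

lemma integrable_W_integrand (m m' : ℕ) (u : ℝ) :
    Integrable fun p : ℂ × ℂ => density m p.1 * density m' p.2 / √(u ^ 2 + ‖p.1 - p.2‖ ^ 2) := by
  refine (integrable_density_mul_div_norm_sub m m').mono'
    (Measurable.aestronglyMeasurable (by fun_prop)) ?_
  filter_upwards [W_integrand_le m m' u] with p hp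
  have h0 := density_nonneg m p.1
  have h0' := density_nonneg m' p.2
  rwa [Real.norm_of_nonneg (by positivity)]

lemma exists_W_le (m m' : ℕ) : ∃ C : ℝ, ∀ u, W m m' u ≤ C :=
  ⟨_, fun u => integral_mono_ae (integrable_W_integrand m m' u)
    (integrable_density_mul_div_norm_sub m m') (W_integrand_le m m' u)⟩

lemma exists_le_W (m m' : ℕ) : ∃ c : ℝ, 0 < c ∧ ∀ u, c / (1 + |u|) ≤ W m m' u := by
  refine ⟨_, mul_pos (integral_density_div_one_add_norm_pos m)
    (integral_density_div_one_add_norm_pos m'), fun u => ?_⟩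
  rw [← integral_prod_mul, ← integral_div]
  refine integral_mono_ae (((integrable_density_div_one_add_norm m).mul_prod
    (integrable_density_div_one_add_norm m')).div_const _) (integrable_W_integrand m m' u) ?_
  filter_upwards [ae_norm_sub_pos] with p hp
  have hd : 0 ≤ density m p.1 * density m' p.2 :=
    mul_nonneg (density_nonneg m p.1) (density_nonneg m' p.2)
  have hs : ‖p.1 - p.2‖ ≤ (1 + ‖p.1‖) * (1 + ‖p.2‖) - 1 := by
    nlinarith [norm_sub_le p.1 p.2, norm_nonneg p.1, norm_nonneg p.2]
  have h := mul_le_mul_of_nonneg_left (le_one_div_sqrt u hp hs) hd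
  calc _ = density m p.1 * density m' p.2
        * (1 / ((1 + |u|) * (1 + ((1 + ‖p.1‖) * (1 + ‖p.2‖) - 1)))) := by
        rw [add_sub_cancel]
        field_simp
    _ ≤ _ := h
    _ = _ := (div_eq_mul_one_div _ _).symm

/-- The properties of the interaction used in the bound on `Nmax`. -/
structure IsRepulsion (w : ℝ → ℝ) (c C : ℝ) : Prop where
  measurable : Measurable w
  nonneg : ∀ u, 0 ≤ w u
  le : ∀ u, w u ≤ C
  ge : ∀ u, c / (1 + |u|) ≤ w u

lemma exists_isRepulsion_W (m m' : ℕ) : ∃ c C : ℝ, 0 < c ∧ IsRepulsion (W m m') c C := by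
  obtain ⟨C, hC⟩ := exists_W_le m m'
  obtain ⟨c, hc, h⟩ := exists_le_W m m'
  exact ⟨c, C, hc, measurable_W m m', W_nonneg m m', hC, h⟩

lemma exists_isRepulsion_WLower (m : ℕ) : ∃ c C : ℝ, 0 < c ∧ IsRepulsion (WLower m) c C := by
  obtain ⟨C, hC0, hC⟩ := exists_V_le (2 * m)
  obtain ⟨c, hc, h⟩ := exists_le_V (2 * m)
  have h2 : 1 ≤ √2 := Real.one_le_sqrt.2 one_le_two
  refine ⟨(√2)⁻¹ * c, (√2)⁻¹ * C, by positivity, ?_, fun u => ?_, fun u => ?_, fun u => ?_⟩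
  · exact ((measurable_V (2 * m)).comp (measurable_id.div_const _)).const_mul _
  · exact mul_nonneg (by positivity) (V_nonneg _ _)
  · refine mul_le_mul_of_nonneg_left ((hC _).trans (div_le_self hC0.le ?_)) (by positivity)
    exact Real.one_le_sqrt.2 (by nlinarith [sq_nonneg (u / √2)])
  · rw [mul_div_assoc]
    refine mul_le_mul_of_nonneg_left (le_trans ?_ (h _)) (by positivity)
    refine div_le_div_of_nonneg_left hc.le (by positivity) (add_le_add_right ?_ 1)
    rw [abs_div, abs_of_pos (show (0 : ℝ) < √2 by positivity)]
    exact div_le_self (abs_nonneg u) h2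

/-! ### Partial derivatives and slices -/

section Partial

variable {n : ℕ} {E : Type*} [NormedAddCommGroup E] [NormedSpace ℝ E]

/-- The partial derivative `∂f/∂x_j`. -/
def pd (j : Fin n) (f : (Fin n → ℝ) → E) (x : Fin n → ℝ) : E :=
  deriv (fun t : ℝ => f (Function.update x j t)) (x j)

lemma hasDerivAt_comp_update {f : (Fin n → ℝ) → E} (hf : Differentiable ℝ f) (j : Fin n)
    (x : Fin n → ℝ) (t : ℝ) :
    HasDerivAt (fun s => f (Function.update x j s))
      (fderiv ℝ f (Function.update x j t) (Pi.single j 1)) t :=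
  (hf _).hasFDerivAt.comp_hasDerivAt t (hasDerivAt_update x j t)

lemma pd_eq_fderiv {f : (Fin n → ℝ) → E} (hf : Differentiable ℝ f) (j : Fin n) (x : Fin n → ℝ) :
    pd j f x = fderiv ℝ f x (Pi.single j 1) := by
  simpa [pd] using (hasDerivAt_comp_update hf j x (x j)).deriv

lemma hasDerivAt_pd {f : (Fin n → ℝ) → E} (hf : Differentiable ℝ f) (j : Fin n)
    (x : Fin n → ℝ) : HasDerivAt (fun s => f (Function.update x j s)) (pd j f x) (x j) :=
  (hasDerivAt_comp_update hf j x (x j)).differentiableAt.hasDerivAt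

lemma contDiff_pd {f : (Fin n → ℝ) → E} (hf : ContDiff ℝ ∞ f) (j : Fin n) :
    ContDiff ℝ ∞ (pd j f) := by
  rw [funext (pd_eq_fderiv (hf.differentiable (by simp)) j)]
  exact (hf.fderiv_right (m := ∞) (by simp)).clm_apply contDiff_const

lemma hasCompactSupport_pd {f : (Fin n → ℝ) → E} (hf : Differentiable ℝ f)
    (hc : HasCompactSupport f) (j : Fin n) : HasCompactSupport (pd j f) := by
  rw [funext (pd_eq_fderiv hf j)]
  exact hc.fderiv_apply ℝ _

lemma integral_pd_eq_zero {f : (Fin n → ℝ) → E} (hf : ContDiff ℝ ∞ f)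
    (hc : HasCompactSupport f) (j : Fin n) : ∫ x, pd j f x = 0 := by
  have hd : Differentiable ℝ f := hf.differentiable (by simp)
  have hi := (contDiff_pd hf j).continuous.integrable_of_hasCompactSupport (μ := volume)
    (hasCompactSupport_pd hd hc j)
  have h := integral_smul_fderiv_eq_neg_fderiv_smul_of_integrable (μ := volume) (𝕜 := ℝ)
    (f := fun _ : Fin n → ℝ => (1 : ℝ)) (g := f) (v := Pi.single j 1) (by simp)
    (by simpa [← pd_eq_fderiv hd j] using hi)
    (by simpa using hf.continuous.integrable_of_hasCompactSupport hc)
    (fun _ _ => by fun_prop) (fun x _ => hd x)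
  simpa [← pd_eq_fderiv hd j] using h

lemma secondPartial_eq {f : (Fin n → ℝ) → ℂ} (hf : ContDiff ℝ ∞ f) (j : Fin n)
    (x : Fin n → ℝ) : secondPartial j f x = pd j (pd j f) x := by
  have hd : Differentiable ℝ f := hf.differentiable (by simp)
  rw [secondPartial, iteratedDeriv_succ, iteratedDeriv_one, pd]
  congr 1
  funext t
  rw [(hasDerivAt_comp_update hd j x t).deriv, pd_eq_fderiv hd]

lemma pd_insertNth (f : (Fin (n + 1) → ℝ) → E) (k : Fin (n + 1)) (t : ℝ) (i : Fin n)
    (y : Fin n → ℝ) :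
    pd i (fun y => f (k.insertNth t y)) y = pd (k.succAbove i) f (k.insertNth t y) := by
  simp only [pd]
  congr 1
  · funext s
    rw [Fin.insertNth_update]
  · simp

lemma contDiff_insertNth (k : Fin (n + 1)) (t : ℝ) :
    ContDiff ℝ ∞ fun y : Fin n → ℝ => (k.insertNth t y : Fin (n + 1) → ℝ) := by
  refine contDiff_pi.2 ((Fin.forall_iff_succAbove k).2 ⟨?_, fun i => ?_⟩)
  · simpa using! contDiff_const
  · simpa using! contDiff_apply ℝ ℝ i

lemma hasCompactSupport_comp_insertNth {f : (Fin (n + 1) → ℝ) → ℂ} (hc : HasCompactSupport f)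
    (k : Fin (n + 1)) (t : ℝ) :
    HasCompactSupport fun y : Fin n → ℝ => f (k.insertNth t y) := by
  refine HasCompactSupport.intro (K := (fun x i => x (k.succAbove i)) '' tsupport f)
    (hc.isCompact.image (by fun_prop)) fun y hy => ?_
  by_contra h
  exact hy ⟨_, subset_tsupport f h, by simp⟩

lemma integral_nonneg_of_insertNth {f : (Fin (n + 1) → ℝ) → ℝ} (hf : Integrable f)
    (k : Fin (n + 1)) (h : ∀ t, 0 ≤ ∫ y : Fin n → ℝ, f (k.insertNth t y)) : 0 ≤ ∫ x, f x := by
  have hm := (volume_preserving_piFinSuccAbove (fun _ : Fin (n + 1) => ℝ) k).symm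
  have hi := (hm.integrable_comp_emb (MeasurableEquiv.measurableEmbedding _)).2 hf
  rw [← hm.integral_comp (MeasurableEquiv.measurableEmbedding _)]
  exact (integral_prod _ hi).symm ▸ integral_nonneg h

end Partial

/-! ### The quadratic form of the Hamiltonian -/

section Energy

variable {n : ℕ}

lemma integrable_mul_of_bounded {U f : (Fin n → ℝ) → ℝ} {C : ℝ} (hU : Measurable U)
    (hC : ∀ x, |U x| ≤ C) (hf : Continuous f) (hc : HasCompactSupport f) :
    Integrable fun x => U x * f x :=
  (hf.integrable_of_hasCompactSupport hc).bdd_mul hU.aestronglyMeasurable (ae_of_all _ hC)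

/-- The potential energy of `n` electrons. -/
def potential (v w : ℝ → ℝ) (Z : ℝ) (x : Fin n → ℝ) : ℝ :=
  -(Z * ∑ j, v (x j)) + ∑ j, ∑ k ∈ Finset.Ioi j, w |x j - x k|

/-- The energy density after integration by parts. -/
def energyDensity (v w : ℝ → ℝ) (Z K : ℝ) (φ : (Fin n → ℝ) → ℂ) (x : Fin n → ℝ) : ℝ :=
  K * ∑ j, ‖pd j φ x‖ ^ 2 + potential v w Z x * ‖φ x‖ ^ 2

lemma measurable_potential {v w : ℝ → ℝ} (hv : Measurable v) (hw : Measurable w) (Z : ℝ) :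
    Measurable (potential v w Z : (Fin n → ℝ) → ℝ) := by
  unfold potential
  fun_prop

lemma exists_abs_potential_le {v w : ℝ → ℝ} {A C : ℝ} (hv : ∀ x, |v x| ≤ A)
    (hw : ∀ u, |w u| ≤ C) (Z : ℝ) : ∃ D, ∀ x : Fin n → ℝ, |potential v w Z x| ≤ D := by
  refine ⟨|Z| * ∑ _j : Fin n, A + ∑ j : Fin n, ∑ _k ∈ Finset.Ioi j, C, fun x => ?_⟩
  refine (abs_add_le _ _).trans (add_le_add ?_ ?_)
  · rw [abs_neg, abs_mul]
    refine mul_le_mul_of_nonneg_left ?_ (abs_nonneg Z)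
    exact (Finset.abs_sum_le_sum_abs _ _).trans (Finset.sum_le_sum fun j _ => hv _)
  · refine (Finset.abs_sum_le_sum_abs _ _).trans (Finset.sum_le_sum fun j _ => ?_)
    exact (Finset.abs_sum_le_sum_abs _ _).trans (Finset.sum_le_sum fun k _ => hw _)

variable {v w : ℝ → ℝ} {A C : ℝ}

lemma hasCompactSupport_norm_sq {φ : (Fin n → ℝ) → ℂ} (hc : HasCompactSupport φ) :
    HasCompactSupport fun x => ‖φ x‖ ^ 2 :=
  hc.comp_left (g := fun z : ℂ => ‖z‖ ^ 2) (by simp)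

lemma integrable_norm_sq {φ : (Fin n → ℝ) → ℂ} (hφ : Continuous φ) (hc : HasCompactSupport φ) :
    Integrable fun x => ‖φ x‖ ^ 2 :=
  (hφ.norm.pow 2).integrable_of_hasCompactSupport (hasCompactSupport_norm_sq hc)

lemma integrable_energyDensity (hv : Measurable v) (hw : Measurable w) (hA : ∀ x, |v x| ≤ A)
    (hC : ∀ u, |w u| ≤ C) (Z K : ℝ) {φ : (Fin n → ℝ) → ℂ} (hφ : ContDiff ℝ ∞ φ)
    (hc : HasCompactSupport φ) : Integrable (energyDensity v w Z K φ) := by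
  obtain ⟨D, hD⟩ := exists_abs_potential_le (n := n) hA hC Z
  refine Integrable.add (Integrable.const_mul (integrable_finsetSum _ fun j _ => ?_) _) ?_
  · exact integrable_norm_sq (contDiff_pd hφ j).continuous
      (hasCompactSupport_pd (hφ.differentiable (by simp)) hc j)
  · exact integrable_mul_of_bounded (measurable_potential hv hw Z) hD (hφ.continuous.norm.pow 2)
      (hasCompactSupport_norm_sq hc)

lemma hamiltonian_eq {φ : (Fin n → ℝ) → ℂ} (hφ : ContDiff ℝ ∞ φ) (Z M : ℝ) (x : Fin n → ℝ) :
    hamiltonian v w n Z M φ x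
      = -((1 / M : ℝ) : ℂ) * ∑ j, pd j (pd j φ) x + ((potential v w Z x : ℝ) : ℂ) * φ x := by
  simp only [hamiltonian, potential, secondPartial_eq hφ, Finset.sum_sub_distrib,
    ← Finset.mul_sum, ← Finset.sum_mul]
  push_cast
  rw [← Finset.mul_sum]
  ring

/-- The two integrands differ by `(1 / M) ∑ ∂_j (conj φ ∂_j φ)`, a divergence of a compactly
supported field. -/
lemma re_integral_hamiltonian (hv : Measurable v) (hw : Measurable w) (hA : ∀ x, |v x| ≤ A)
    (hC : ∀ u, |w u| ≤ C) (Z M : ℝ) {φ : (Fin n → ℝ) → ℂ} (hφ : ContDiff ℝ ∞ φ)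
    (hc : HasCompactSupport φ) :
    (∫ x, conj (φ x) * hamiltonian v w n Z M φ x).re = ∫ x, energyDensity v w Z (1 / M) φ x := by
  have hd : Differentiable ℝ φ := hφ.differentiable (by simp)
  have hconj : ContDiff ℝ ∞ fun x => conj (φ x) :=
    (Complex.conjCLE : ℂ →L[ℝ] ℂ).contDiff.comp hφ
  have hcur (j : Fin n) : ContDiff ℝ ∞ fun x => conj (φ x) * pd j φ x :=
    hconj.mul (contDiff_pd hφ j)
  have hcurc (j : Fin n) : HasCompactSupport fun x => conj (φ x) * pd j φ x :=
    (hasCompactSupport_pd hd hc j).mul_left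
  have hpd (j : Fin n) (x : Fin n → ℝ) : pd j (fun x => conj (φ x) * pd j φ x) x
      = ((‖pd j φ x‖ ^ 2 : ℝ) : ℂ) + conj (φ x) * pd j (pd j φ) x := by
    have h1 := (Complex.conjCLE : ℂ →L[ℝ] ℂ).hasFDerivAt.comp_hasDerivAt (x j)
      (hasDerivAt_pd hd j x)
    have h2 := hasDerivAt_pd ((contDiff_pd hφ j).differentiable (by simp)) j x
    have h3 := (h1.mul h2).deriv
    simp only [Function.update_eq_self] at h3
    refine h3.trans ?_
    push_cast
    rw [← Complex.conj_mul']
    simp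
  have hpt (x : Fin n → ℝ) : conj (φ x) * hamiltonian v w n Z M φ x
      = ((energyDensity v w Z (1 / M) φ x : ℝ) : ℂ)
        - ∑ j, ((1 / M : ℝ) : ℂ) * pd j (fun x => conj (φ x) * pd j φ x) x := by
    have hn := Complex.conj_mul' (φ x)
    simp only [hamiltonian_eq hφ, energyDensity, hpd, mul_add, Finset.sum_add_distrib,
      ← Finset.mul_sum]
    push_cast
    rw [← hn]
    ring
  have hi : Integrable fun x => ((energyDensity v w Z (1 / M) φ x : ℝ) : ℂ) :=
    (integrable_energyDensity hv hw hA hC Z (1 / M) hφ hc).ofReal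
  have hi2 (j : Fin n) : Integrable fun x =>
      ((1 / M : ℝ) : ℂ) * pd j (fun x => conj (φ x) * pd j φ x) x :=
    ((contDiff_pd (hcur j) j).continuous.integrable_of_hasCompactSupport
      (hasCompactSupport_pd ((hcur j).differentiable (by simp)) (hcurc j) j)).const_mul _
  simp_rw [hpt]
  rw [integral_sub hi (integrable_finsetSum _ fun j _ => hi2 j), integral_complex_ofReal,
    integral_finsetSum _ fun j _ => hi2 j]
  simp [integral_const_mul, integral_pd_eq_zero (hcur _) (hcurc _)]

/-- The variational principle made homogeneous, for use on slices of a wave function, which are not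
normalized and may vanish. -/
lemma mul_integral_norm_sq_le (hv : Measurable v) (hw : Measurable w) (hA : ∀ x, |v x| ≤ A)
    (hC : ∀ u, |w u| ≤ C) {Z M e : ℝ} (he : (e : EReal) ≤ groundEnergy v w n Z M)
    {φ : (Fin n → ℝ) → ℂ} (hφ : ContDiff ℝ ∞ φ) (hc : HasCompactSupport φ) :
    e * ∫ x, ‖φ x‖ ^ 2 ≤ ∫ x, energyDensity v w Z (1 / M) φ x := by
  by_cases h0 : ∀ x, φ x = 0
  · have : φ = 0 := funext h0
    subst this
    simp [energyDensity, pd]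
  push Not at h0
  obtain ⟨x₀, hx₀⟩ := h0
  have hpos : 0 < ∫ x, ‖φ x‖ ^ 2 :=
    (hφ.continuous.norm.pow 2).integral_pos_of_hasCompactSupport_nonneg_nonzero
      (hasCompactSupport_norm_sq hc) (fun x => by positivity) (x := x₀) (by simpa using hx₀)
  set I := ∫ x, ‖φ x‖ ^ 2 with hI
  have hcI : (√I)⁻¹ ^ 2 = I⁻¹ := by rw [inv_pow, Real.sq_sqrt hpos.le]
  set φ' : (Fin n → ℝ) → ℂ := fun x => (((√I)⁻¹ : ℝ) : ℂ) * φ x with hφ'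
  have hns (z : ℂ) : ‖(((√I)⁻¹ : ℝ) : ℂ) * z‖ ^ 2 = I⁻¹ * ‖z‖ ^ 2 := by
    rw [norm_mul, mul_pow, Complex.norm_real, Real.norm_eq_abs, sq_abs, hcI]
  have ht : IsTrial φ' := by
    refine ⟨contDiff_const.mul hφ, hc.mul_left, ?_⟩
    simp only [hφ', hns]
    rw [integral_const_mul, ← hI, inv_mul_cancel₀ hpos.ne']
  have hE (x) : energyDensity v w Z (1 / M) φ' x = I⁻¹ * energyDensity v w Z (1 / M) φ x := by
    have hp (j : Fin n) : pd j φ' x = (((√I)⁻¹ : ℝ) : ℂ) * pd j φ x :=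
      ((hasDerivAt_pd (hφ.differentiable (by simp)) j x).const_mul _).deriv
    have hx : φ' x = (((√I)⁻¹ : ℝ) : ℂ) * φ x := rfl
    simp only [energyDensity, hp, hx, hns, ← Finset.mul_sum]
    ring
  have h := he.trans (iInf₂_le φ' ht)
  rw [re_integral_hamiltonian hv hw hA hC Z M ht.smooth ht.compactSupport, EReal.coe_le_coe_iff]
    at h
  simp_rw [hE] at h
  rwa [integral_const_mul, inv_mul_eq_div, le_div_iff₀ hpos] at h

end Energy

/-! ### Pair sums and removal of one electron -/

section Sums

variable {n : ℕ}

lemma sum_sum_succAbove (a : Fin (n + 1) → Fin (n + 1) → ℝ) :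
    ∑ k, ∑ i : Fin n, a k (k.succAbove i) = ∑ k, ∑ j, a k j - ∑ k, a k k := by
  rw [← Finset.sum_sub_distrib]
  exact Finset.sum_congr rfl fun k _ => by rw [Fin.sum_univ_succAbove _ k]; ring

lemma sum_sum_succAbove_comm (a : Fin (n + 1) → Fin (n + 1) → ℝ) :
    ∑ k, ∑ i : Fin n, a k (k.succAbove i) = ∑ k, ∑ i : Fin n, a (k.succAbove i) k := by
  rw [sum_sum_succAbove, sum_sum_succAbove fun k j => a j k, Finset.sum_comm]

lemma two_mul_sum_sum_Ioi (a : Fin n → Fin n → ℝ) (h : ∀ j k, a j k = a k j) :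
    2 * ∑ j, ∑ k ∈ Finset.Ioi j, a j k = ∑ j, ∑ k, a j k - ∑ j, a j j := by
  have h1 : ∑ j, ∑ k ∈ Finset.Ioi j, a j k = ∑ j, ∑ k ∈ Finset.Iio j, a j k := by
    rw [Finset.sum_comm' (t' := Finset.univ) (s' := fun k => Finset.Iio k) (by simp)]
    exact Finset.sum_congr rfl fun j _ => Finset.sum_congr rfl fun k _ => h _ _
  have h2 (j : Fin n) : ∑ k, a j k
      = ∑ k ∈ Finset.Iio j, a j k + a j j + ∑ k ∈ Finset.Ioi j, a j k := by
    have hu : (Finset.univ : Finset (Fin n)) = Finset.Iic j ∪ Finset.Ioi j := by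
      ext k; simp [le_or_gt]
    rw [hu, Finset.sum_union (by
      rw [Finset.disjoint_left]; intro k; simp), ← Finset.Iio_insert, Finset.sum_insert (by simp)]
    ring
  rw [two_mul]
  nth_rw 1 [h1]
  simp only [h2, Finset.sum_add_distrib]
  ring

/-- Doubling the sums over `j < k` to sums over all ordered pairs lets index `k` be split off
without regard to order. -/
lemma potential_succ (v w : ℝ → ℝ) (Z : ℝ) (x : Fin (n + 1) → ℝ) (k : Fin (n + 1)) :
    potential v w Z x = potential v w Z (fun i => x (k.succAbove i))
      + (-(Z * v (x k)) + ∑ i : Fin n, w |x k - x (k.succAbove i)|) := by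
  have h1 := two_mul_sum_sum_Ioi (fun j k => w |x j - x k|) fun j k => by rw [abs_sub_comm]
  have h2 := two_mul_sum_sum_Ioi
    (fun i j => w |x (k.succAbove i) - x (k.succAbove j)|) fun j k => by rw [abs_sub_comm]
  have e1 : ∑ j, ∑ l, w |x j - x l|
      = (w |x k - x k| + ∑ i : Fin n, w |x k - x (k.succAbove i)|)
        + ∑ i : Fin n, (w |x (k.succAbove i) - x k|
          + ∑ j : Fin n, w |x (k.succAbove i) - x (k.succAbove j)|) := by
    rw [Fin.sum_univ_succAbove _ k, Fin.sum_univ_succAbove _ k]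
    congr 1
    exact Finset.sum_congr rfl fun i _ => Fin.sum_univ_succAbove _ k
  rw [e1, Finset.sum_add_distrib, Fin.sum_univ_succAbove (fun j => w |x j - x j|) k] at h1
  have h3 : ∑ i : Fin n, w |x (k.succAbove i) - x k| = ∑ i : Fin n, w |x k - x (k.succAbove i)| :=
    Finset.sum_congr rfl fun i _ => by rw [abs_sub_comm]
  simp only [potential]
  rw [Fin.sum_univ_succAbove (fun j => v (x j)) k, mul_add]
  linarith

end Sums

/-! ### The weight and the bounded primitive -/

section Weight

/-- The weight of the virial-type argument, growing linearly beyond the length scale `R`. -/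
def weight (R x : ℝ) : ℝ := √(R ^ 2 + x ^ 2)

/-- A bounded function whose derivative approximates `(1 + x²)^{-1/2}` up to the scale `R`. -/
def arsinhDiff (R x : ℝ) : ℝ := Real.arsinh x - Real.arsinh (x / R)

variable {R : ℝ}

lemma le_weight (R x : ℝ) : R ≤ weight R x :=
  Real.le_sqrt_of_sq_le (by nlinarith [sq_nonneg x])

lemma weight_pos (hR : 0 < R) (x : ℝ) : 0 < weight R x := hR.trans_le (le_weight R x)

lemma abs_le_weight (R x : ℝ) : |x| ≤ weight R x :=
  Real.abs_le_sqrt (by nlinarith [sq_nonneg R])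

lemma weight_le (hR : 0 < R) (x : ℝ) : weight R x ≤ R + |x| := by
  rw [weight, Real.sqrt_le_left (by positivity), ← sq_abs x]
  nlinarith [abs_nonneg x]

lemma contDiff_weight (hR : 0 < R) : ContDiff ℝ ∞ (weight R) :=
  ContDiff.sqrt (by fun_prop) fun x => by positivity

lemma hasDerivAt_weight (hR : 0 < R) (x : ℝ) :
    HasDerivAt (weight R) (x / weight R x) x := by
  have h := (((hasDerivAt_id x).pow 2).const_add (R ^ 2)).sqrt (by simp; positivity)
  refine h.congr_deriv ?_
  simp only [weight, id]
  have : 0 < √(R ^ 2 + x ^ 2) := by positivity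
  simp
  field_simp

lemma abs_div_weight_le_one (hR : 0 < R) (x : ℝ) : |x / weight R x| ≤ 1 := by
  rw [abs_div, abs_of_pos (weight_pos hR x), div_le_one (weight_pos hR x)]
  exact abs_le_weight R x

lemma contDiff_arsinhDiff (R : ℝ) : ContDiff ℝ ∞ (arsinhDiff R) :=
  Real.contDiff_arsinh.sub (ContDiff.arsinh (by fun_prop))

lemma hasDerivAt_arsinhDiff (hR : 0 < R) (x : ℝ) :
    HasDerivAt (arsinhDiff R) ((√(1 + x ^ 2))⁻¹ - (weight R x)⁻¹) x := by
  have h := (Real.hasDerivAt_arsinh x).sub ((hasDerivAt_id x).div_const R).arsinh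
  refine h.congr_deriv ?_
  have h1 : weight R x = R * √(1 + (x / R) ^ 2) := by
    rw [weight, show R ^ 2 + x ^ 2 = R ^ 2 * (1 + (x / R) ^ 2) by field_simp,
      Real.sqrt_mul (by positivity), Real.sqrt_sq hR.le]
  rw [h1]
  simp [mul_comm]

lemma arsinhDiff_neg (R x : ℝ) : arsinhDiff R (-x) = -arsinhDiff R x := by
  simp only [arsinhDiff, neg_div, Real.arsinh_neg]
  ring

lemma abs_arsinhDiff_le (hR : 1 ≤ R) (x : ℝ) : |arsinhDiff R x| ≤ Real.log R := by
  have hR0 : 0 < R := by linarith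
  have key : ∀ y : ℝ, 0 ≤ y → |arsinhDiff R y| ≤ Real.log R := fun y hy => by
    have h0 : y / R ≤ y := div_le_self hy hR
    have h1 : 0 ≤ arsinhDiff R y := sub_nonneg.2 (Real.arsinh_le_arsinh.2 h0)
    -- After exponentiation the claim is `y + √(1 + y²) ≤ y + √(R² + y²)`.
    rw [abs_of_nonneg h1, arsinhDiff, sub_le_iff_le_add, ← Real.exp_le_exp, Real.exp_add,
      Real.exp_log hR0, Real.exp_arsinh, Real.exp_arsinh]
    have e : R * √(1 + (y / R) ^ 2) = √(R ^ 2 + y ^ 2) := by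
      rw [show R ^ 2 + y ^ 2 = R ^ 2 * (1 + (y / R) ^ 2) by field_simp,
        Real.sqrt_mul (by positivity), Real.sqrt_sq hR0.le]
    rw [mul_add, e, mul_div_cancel₀ _ hR0.ne']
    gcongr
    nlinarith
  rcases le_total 0 x with h | h
  · exact key x h
  · rw [← abs_neg, ← arsinhDiff_neg]
    exact key _ (by linarith)

/-- From `weight R x ≤ R + |x|`; the constant 2 pays for `|x| / √(1 + x²) ≤ 1` and for the
subtracted `R / weight R x ≤ 1`. -/
lemma weight_mul_le (hR : 0 < R) {C y : ℝ} (x : ℝ) (hC : 0 ≤ C) (hy : y ≤ C / √(1 + x ^ 2)) :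
    weight R x * y ≤ C * (R * ((√(1 + x ^ 2))⁻¹ - (weight R x)⁻¹) + 2) := by
  have hs : 0 < √(1 + x ^ 2) := by positivity
  have h1 : weight R x * y ≤ (R + |x|) * (C / √(1 + x ^ 2)) :=
    (mul_le_mul_of_nonneg_left hy (weight_pos hR x).le).trans
      (mul_le_mul_of_nonneg_right (weight_le hR x) (by positivity))
  have h2 : |x| * (√(1 + x ^ 2))⁻¹ ≤ 1 := by
    rw [← div_eq_mul_inv, div_le_one hs]
    exact Real.abs_le_sqrt (by linarith)
  have h3 : R * (weight R x)⁻¹ ≤ 1 := by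
    rw [← div_eq_mul_inv, div_le_one (weight_pos hR x)]
    exact le_weight R x
  have h4 : C * (R * (√(1 + x ^ 2))⁻¹ + |x| * (√(1 + x ^ 2))⁻¹)
      ≤ C * (R * ((√(1 + x ^ 2))⁻¹ - (weight R x)⁻¹) + 2) :=
    mul_le_mul_of_nonneg_left (by linarith) hC
  calc _ ≤ _ := h1
    _ = C * (R * (√(1 + x ^ 2))⁻¹ + |x| * (√(1 + x ^ 2))⁻¹) := by ring
    _ ≤ _ := h4

lemma half_le_weight_add_div (hR : 1 ≤ R) (x y : ℝ) :
    1 / 2 ≤ (weight R x + weight R y) / (1 + |x - y|) := by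
  rw [le_div_iff₀ (by positivity)]
  linarith [le_weight R x, le_weight R y, abs_le_weight R x, abs_le_weight R y, abs_sub x y]

end Weight

/-- The one-body inequality behind the bound on the number of electrons. -/
lemma one_body_le {Z L C g g' s s' u p d ρ : ℝ} (hZ : 0 < Z) (hL : 0 < L) (hC : 0 ≤ C)
    (hg : 1 + L ≤ g) (hg' : |g'| ≤ 1) (hu : g * u ≤ C * ((1 + L) * s' + 2))
    (hs : |s| ≤ Real.log (1 + L)) (hρ : |ρ| ≤ p * d) :
    -((1 / 2 + 2 * C + 4 * C ^ 2) * Z * (1 + Real.log (1 + L) ^ 2)) * p ^ 2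
        - Z * C * (1 + L) * (s' * p ^ 2 + 2 * s * ρ)
      ≤ Z * L * (g * d ^ 2 + g' * ρ) - g * (Z * u) * p ^ 2 := by
  set ℓ := Real.log (1 + L) with hℓ
  have hℓ0 : 0 ≤ ℓ := Real.log_nonneg (by linarith)
  have hℓL : ℓ ≤ L := by
    have := Real.log_le_sub_one_of_pos (show 0 < 1 + L by linarith)
    linarith
  have h1 : (1 + L) * d ^ 2 ≤ g * d ^ 2 := by gcongr
  have h2 : -(p * d) ≤ g' * ρ := by
    have : |g' * ρ| ≤ 1 * (p * d) := by
      rw [abs_mul]; gcongr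
    linarith [neg_abs_le (g' * ρ)]
  have h3 : -(ℓ * (p * d)) ≤ s * ρ := by
    have : |s * ρ| ≤ ℓ * (p * d) := by
      rw [abs_mul]; gcongr
    linarith [neg_abs_le (s * ρ)]
  have h4 : g * u * p ^ 2 ≤ C * ((1 + L) * s' + 2) * p ^ 2 := by gcongr
  -- the kinetic energy absorbs both error terms
  have h5 : L * (p * d) ≤ L * (1 + L) / 2 * d ^ 2 + p ^ 2 / 2 := by
    have : 0 ≤ (L * d - p) ^ 2 + L * d ^ 2 := by positivity
    nlinarith
  have h6 : 2 * C * (1 + L) * (ℓ * (p * d)) ≤ L * (1 + L) / 2 * d ^ 2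
      + 4 * C ^ 2 * (1 + ℓ ^ 2) * p ^ 2 := by
    have e1 : 2 * C * (1 + L) * (ℓ * (p * d)) ≤ L * (1 + L) / 2 * d ^ 2
        + 2 * C ^ 2 * ((1 + L) * ℓ ^ 2 / L) * p ^ 2 := by
      have : 0 ≤ (1 + L) / (2 * L) * (L * d - 2 * C * ℓ * p) ^ 2 := by positivity
      have e : (1 + L) / (2 * L) * (L * d - 2 * C * ℓ * p) ^ 2 = L * (1 + L) / 2 * d ^ 2
        + 2 * C ^ 2 * ((1 + L) * ℓ ^ 2 / L) * p ^ 2 - 2 * C * (1 + L) * (ℓ * (p * d)) := by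
        field_simp; ring
      linarith
    -- Since `ℓ ≤ L`, the term `ℓ² / L` is at most `ℓ`, so the bound does not degenerate as `L → 0`.
    have e2 : (1 + L) * ℓ ^ 2 / L ≤ 2 * (1 + ℓ ^ 2) := by
      rw [div_le_iff₀ hL]
      nlinarith [sq_nonneg (ℓ - 1), mul_nonneg hℓ0 (sub_nonneg.2 hℓL)]
    have e3 : 2 * C ^ 2 * ((1 + L) * ℓ ^ 2 / L) * p ^ 2 ≤ 2 * C ^ 2 * (2 * (1 + ℓ ^ 2)) * p ^ 2 := by
      gcongr
    linarith
  have h7 : 0 ≤ (1 / 2 + 2 * C) * ℓ ^ 2 * p ^ 2 := by positivity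
  have h8 : L * (p * d) * -1 ≤ L * (g' * ρ) := by nlinarith
  have h9 : 2 * C * (1 + L) * -(ℓ * (p * d)) ≤ 2 * C * (1 + L) * (s * ρ) := by gcongr
  have h10 : L * ((1 + L) * d ^ 2) ≤ L * (g * d ^ 2) := by gcongr
  have h11 : 0 ≤ L * (g * d ^ 2 + g' * ρ) - g * u * p ^ 2
      + (1 / 2 + 2 * C + 4 * C ^ 2) * (1 + ℓ ^ 2) * p ^ 2
      + C * (1 + L) * (s' * p ^ 2 + 2 * s * ρ) := by linarith
  nlinarith [mul_nonneg hZ.le h11]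

/-! ### The weighted energy inequality -/

section Main

variable {n : ℕ} {R : ℝ}

/-- The sum of the one-particle weights. -/
def totalWeight (R : ℝ) (x : Fin n → ℝ) : ℝ := ∑ k, weight R (x k)

lemma totalWeight_pos (hR : 0 < R) (x : Fin (n + 1) → ℝ) : 0 < totalWeight R x :=
  Finset.sum_pos (fun _ _ => weight_pos hR _) Finset.univ_nonempty

lemma contDiff_sqrt_totalWeight (hR : 0 < R) :
    ContDiff ℝ ∞ fun x : Fin (n + 1) → ℝ => √(totalWeight R x) := by
  refine ContDiff.sqrt ?_ fun x => (totalWeight_pos hR x).ne'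
  exact ContDiff.sum fun k _ => (contDiff_weight hR).comp (contDiff_apply ℝ ℝ k)

lemma hasDerivAt_totalWeight (hR : 0 < R) (x : Fin n → ℝ) (j : Fin n) :
    HasDerivAt (fun t => totalWeight R (Function.update x j t)) (x j / weight R (x j)) (x j) := by
  have h (k : Fin n) : HasDerivAt (fun t => weight R (Function.update x j t k))
      (if k = j then x j / weight R (x j) else 0) (x j) := by
    split_ifs with hk
    · subst hk
      simpa using hasDerivAt_weight hR (x k)
    · simpa [Function.update_of_ne hk] using hasDerivAt_const (x j) (weight R (x k))
  have h2 := HasDerivAt.fun_sum (u := Finset.univ) fun k _ => h k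
  simpa [totalWeight] using h2

lemma pd_sqrt_totalWeight (hR : 0 < R) (x : Fin (n + 1) → ℝ) (j : Fin (n + 1)) :
    2 * √(totalWeight R x) * pd j (fun x => √(totalWeight R x)) x = x j / weight R (x j) := by
  have hG := totalWeight_pos hR x
  have h := ((hasDerivAt_totalWeight hR x j).sqrt (by simpa using hG.ne')).deriv
  simp only [Function.update_eq_self] at h
  rw [pd, h]
  field_simp

lemma norm_sq_add_ge (a b : ℝ) (u z : ℂ) :
    a ^ 2 * ‖u‖ ^ 2 + 2 * a * b * (conj z * u).re ≤ ‖(a : ℂ) * u + (b : ℂ) * z‖ ^ 2 := by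
  rw [← Complex.normSq_eq_norm_sq, ← Complex.normSq_eq_norm_sq]
  simp only [Complex.normSq_apply, Complex.add_re, Complex.add_im, Complex.re_ofReal_mul,
    Complex.im_ofReal_mul]
  simp only [Complex.mul_re, Complex.conj_re, Complex.conj_im]
  nlinarith [sq_nonneg (b * z.re), sq_nonneg (b * z.im)]

/-- Expanding the square, the cross term carries `2 √G ∂_j √G = ∂_j G`, and the nonnegative term
`(∂_j √G)² ‖ψ‖²` is dropped. -/
lemma pd_sqrt_totalWeight_mul_ge (hR : 0 < R) {ψ : (Fin (n + 1) → ℝ) → ℂ}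
    (hψ : Differentiable ℝ ψ) (x : Fin (n + 1) → ℝ) (j : Fin (n + 1)) :
    totalWeight R x * ‖pd j ψ x‖ ^ 2 + x j / weight R (x j) * (conj (ψ x) * pd j ψ x).re
      ≤ ‖pd j (fun x => ((√(totalWeight R x) : ℝ) : ℂ) * ψ x) x‖ ^ 2 := by
  have hF : Differentiable ℝ fun x : Fin (n + 1) → ℝ => √(totalWeight R x) :=
    (contDiff_sqrt_totalWeight hR).differentiable (by simp)
  have h := ((hasDerivAt_pd hF j x).ofReal_comp.mul (hasDerivAt_pd hψ j x)).deriv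
  simp only [Function.update_eq_self] at h
  have h2 : pd j (fun x => ((√(totalWeight R x) : ℝ) : ℂ) * ψ x) x
      = ((√(totalWeight R x) : ℝ) : ℂ) * pd j ψ x
        + ((pd j (fun x => √(totalWeight R x)) x : ℝ) : ℂ) * ψ x := by
    exact h.trans (add_comm _ _)
  rw [h2]
  refine le_trans (le_of_eq ?_) (norm_sq_add_ge _ _ _ _)
  rw [Real.sq_sqrt (totalWeight_pos hR x).le, pd_sqrt_totalWeight hR]

/-- The energy density, relative to `e`, of the `n` electrons other than electron `k`. -/
def reducedDensity (v w : ℝ → ℝ) (Z K e : ℝ) (ψ : (Fin (n + 1) → ℝ) → ℂ) (k : Fin (n + 1))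
    (x : Fin (n + 1) → ℝ) : ℝ :=
  K * ∑ i : Fin n, ‖pd (k.succAbove i) ψ x‖ ^ 2
    + potential v w Z (fun i => x (k.succAbove i)) * ‖ψ x‖ ^ 2 - e * ‖ψ x‖ ^ 2

lemma hasDerivAt_norm_sq {f : ℝ → ℂ} {f' : ℂ} {t : ℝ} (hf : HasDerivAt f f' t) :
    HasDerivAt (fun t => ‖f t‖ ^ 2) (2 * (conj (f t) * f').re) t := by
  have h := hf.norm_sq
  rw [Complex.inner, mul_comm f'] at h
  exact h

lemma pd_arsinhDiff_mul_norm_sq (hR : 0 < R) {ψ : (Fin n → ℝ) → ℂ}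
    (hψ : Differentiable ℝ ψ) (x : Fin n → ℝ) (k : Fin n) :
    pd k (fun x => arsinhDiff R (x k) * ‖ψ x‖ ^ 2) x
      = ((√(1 + x k ^ 2))⁻¹ - (weight R (x k))⁻¹) * ‖ψ x‖ ^ 2
        + 2 * arsinhDiff R (x k) * (conj (ψ x) * pd k ψ x).re := by
  have h := ((hasDerivAt_arsinhDiff hR (x k)).mul
    (hasDerivAt_norm_sq (hasDerivAt_pd hψ k x))).deriv
  simp only [Function.update_eq_self] at h
  rw [pd]
  simp only [Function.update_self]
  refine h.trans ?_
  ring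

/-- Symmetrizing in the pair replaces `g(x_k)` by the mean of the two weights, whose linear growth
cancels the decay of the repulsion. -/
lemma sum_weight_mul_repulsion_ge {w : ℝ → ℝ} {c D : ℝ} (hc : 0 ≤ c) (hw : IsRepulsion w c D)
    (hR : 1 ≤ R) (x : Fin (n + 1) → ℝ) :
    (n + 1) * (n * c / 4)
      ≤ ∑ k, weight R (x k) * ∑ i : Fin n, w |x k - x (k.succAbove i)| := by
  have h1 : ∑ k, weight R (x k) * ∑ i : Fin n, w |x k - x (k.succAbove i)|
      = ∑ k, ∑ i : Fin n,
        (weight R (x k) + weight R (x (k.succAbove i))) / 2 * w |x k - x (k.succAbove i)| := by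
    have h := sum_sum_succAbove_comm fun k j => weight R (x k) * w |x k - x j|
    have h' : ∑ k, ∑ i : Fin n, weight R (x (k.succAbove i)) * w |x (k.succAbove i) - x k|
        = ∑ k, ∑ i : Fin n, weight R (x (k.succAbove i)) * w |x k - x (k.succAbove i)| :=
      Finset.sum_congr rfl fun k _ => Finset.sum_congr rfl fun i _ => by rw [abs_sub_comm]
    rw [h'] at h
    simp only [add_div, add_mul, Finset.sum_add_distrib, div_mul_eq_mul_div, ← Finset.sum_div,
      Finset.mul_sum]
    linarith
  rw [h1]
  have h2 (k : Fin (n + 1)) (i : Fin n) : c / 4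
      ≤ (weight R (x k) + weight R (x (k.succAbove i))) / 2 * w |x k - x (k.succAbove i)| := by
    have hg := half_le_weight_add_div hR (x k) (x (k.succAbove i))
    have hw' := hw.ge |x k - x (k.succAbove i)|
    rw [abs_abs] at hw'
    have h0 := weight_pos (show 0 < R by linarith) (x k)
    have h0' := weight_pos (show 0 < R by linarith) (x (k.succAbove i))
    calc c / 4 = c / 2 * (1 / 2) := by ring
      _ ≤ c / 2 * ((weight R (x k) + weight R (x (k.succAbove i)))
          / (1 + |x k - x (k.succAbove i)|)) := by gcongr
      _ = (weight R (x k) + weight R (x (k.succAbove i))) / 2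
          * (c / (1 + |x k - x (k.succAbove i)|)) := by ring
      _ ≤ _ := by gcongr
  calc ((n : ℝ) + 1) * (n * c / 4) = ∑ _k : Fin (n + 1), ∑ _i : Fin n, c / 4 := by
        simp only [Finset.sum_const, Finset.card_univ, Fintype.card_fin, nsmul_eq_mul]
        push_cast
        ring
    _ ≤ _ := Finset.sum_le_sum fun k _ => Finset.sum_le_sum fun i _ => h2 k i

/-- The constant in front of `Z (1 + log² R)` in the one-body inequality. -/
def oneBodyConst (C : ℝ) : ℝ := 1 / 2 + 2 * C + 4 * C ^ 2

/-- On the left, the first sum has nonnegative integral when `e` is at most the `n`-electron ground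
energy, and the second integrates to zero. The assumption `hn` makes the repulsion outweigh the
one-body errors. -/
lemma energyDensity_ge {v w : ℝ → ℝ} {c C D Z L : ℝ} (hc : 0 ≤ c) (hw : IsRepulsion w c D)
    (hC : 0 ≤ C) (hv : ∀ x, v x ≤ C / √(1 + x ^ 2)) (hZ : 0 < Z) (hL : 0 < L)
    (hn : 4 * (oneBodyConst C * Z * (1 + Real.log (1 + L) ^ 2)) ≤ n * c) (e : ℝ)
    {ψ : (Fin (n + 1) → ℝ) → ℂ} (hψ : Differentiable ℝ ψ) (x : Fin (n + 1) → ℝ) :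
    ∑ k, weight (1 + L) (x k) * reducedDensity v w Z (Z * L) e ψ k x
        - Z * C * (1 + L) * ∑ k, pd k (fun x => arsinhDiff (1 + L) (x k) * ‖ψ x‖ ^ 2) x
      ≤ energyDensity v w Z (Z * L) (fun x => ((√(totalWeight (1 + L) x) : ℝ) : ℂ) * ψ x) x
        - e * ‖((√(totalWeight (1 + L) x) : ℝ) : ℂ) * ψ x‖ ^ 2 := by
  have hR : 0 < 1 + L := by linarith
  have hnorm : ‖((√(totalWeight (1 + L) x) : ℝ) : ℂ) * ψ x‖ ^ 2
      = (∑ k, weight (1 + L) (x k)) * ‖ψ x‖ ^ 2 := by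
    rw [norm_mul, mul_pow, Complex.norm_real, Real.norm_eq_abs, sq_abs,
      Real.sq_sqrt (totalWeight_pos hR x).le, totalWeight]
  have hkin : Z * L * ∑ j, (totalWeight (1 + L) x * ‖pd j ψ x‖ ^ 2
      + x j / weight (1 + L) (x j) * (conj (ψ x) * pd j ψ x).re)
      ≤ Z * L * ∑ j, ‖pd j (fun x => ((√(totalWeight (1 + L) x) : ℝ) : ℂ) * ψ x) x‖ ^ 2 :=
    mul_le_mul_of_nonneg_left
      (Finset.sum_le_sum fun j _ => pd_sqrt_totalWeight_mul_ge hR hψ x j) (by positivity)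
  have hkin2 : ∑ j, totalWeight (1 + L) x * ‖pd j ψ x‖ ^ 2
      = ∑ k, weight (1 + L) (x k) * (‖pd k ψ x‖ ^ 2
        + ∑ i : Fin n, ‖pd (k.succAbove i) ψ x‖ ^ 2) := by
    rw [← Finset.mul_sum, totalWeight, Finset.sum_mul]
    exact Finset.sum_congr rfl fun k _ => by rw [Fin.sum_univ_succAbove _ k]
  have hpot : (∑ k, weight (1 + L) (x k)) * potential v w Z x
      = ∑ k, weight (1 + L) (x k) * (potential v w Z (fun i => x (k.succAbove i))
        + (-(Z * v (x k)) + ∑ i : Fin n, w |x k - x (k.succAbove i)|)) := by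
    rw [Finset.sum_mul]
    exact Finset.sum_congr rfl fun k _ => by rw [← potential_succ v w Z x k]
  have hrep := mul_le_mul_of_nonneg_right (sum_weight_mul_repulsion_ge hc hw
    (show 1 ≤ 1 + L by linarith) x) (sq_nonneg ‖ψ x‖)
  have hone (k : Fin (n + 1)) : -(oneBodyConst C * Z * (1 + Real.log (1 + L) ^ 2)) * ‖ψ x‖ ^ 2
      - Z * C * (1 + L) * pd k (fun x => arsinhDiff (1 + L) (x k) * ‖ψ x‖ ^ 2) x
      ≤ Z * L * (weight (1 + L) (x k) * ‖pd k ψ x‖ ^ 2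
        + x k / weight (1 + L) (x k) * (conj (ψ x) * pd k ψ x).re)
        - weight (1 + L) (x k) * (Z * v (x k)) * ‖ψ x‖ ^ 2 := by
    rw [pd_arsinhDiff_mul_norm_sq hR hψ]
    refine one_body_le hZ hL hC (le_weight _ _) (abs_div_weight_le_one hR _)
      (weight_mul_le hR _ hC (hv _)) (abs_arsinhDiff_le (by linarith) _) ?_
    refine (Complex.abs_re_le_norm _).trans ?_
    rw [norm_mul, RCLike.norm_conj]
  have hsum := Finset.sum_le_sum fun k (_ : k ∈ Finset.univ) => hone k
  have hn' : ((n : ℝ) + 1) * (oneBodyConst C * Z * (1 + Real.log (1 + L) ^ 2)) * ‖ψ x‖ ^ 2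
      ≤ (n + 1) * (n * c / 4) * ‖ψ x‖ ^ 2 := by
    gcongr
    linarith
  have hsplit : ∑ j, (totalWeight (1 + L) x * ‖pd j ψ x‖ ^ 2
      + x j / weight (1 + L) (x j) * (conj (ψ x) * pd j ψ x).re)
      = ∑ k, (weight (1 + L) (x k) * (‖pd k ψ x‖ ^ 2 + ∑ i : Fin n, ‖pd (k.succAbove i) ψ x‖ ^ 2)
        + x k / weight (1 + L) (x k) * (conj (ψ x) * pd k ψ x).re) := by
    rw [Finset.sum_add_distrib, hkin2, ← Finset.sum_add_distrib]
  rw [hsplit] at hkin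
  -- An algebraic regrouping that exposes exactly the quantities controlled by `hkin`, `hsum`, `hn'`
  -- and `hrep`.
  have hdiff : ∑ k, weight (1 + L) (x k) * reducedDensity v w Z (Z * L) e ψ k x
        - Z * C * (1 + L) * ∑ k, pd k (fun x => arsinhDiff (1 + L) (x k) * ‖ψ x‖ ^ 2) x
      = Z * L * ∑ k, (weight (1 + L) (x k)
            * (‖pd k ψ x‖ ^ 2 + ∑ i : Fin n, ‖pd (k.succAbove i) ψ x‖ ^ 2)
          + x k / weight (1 + L) (x k) * (conj (ψ x) * pd k ψ x).re)
        + (∑ k, weight (1 + L) (x k)) * potential v w Z x * ‖ψ x‖ ^ 2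
        - e * ((∑ k, weight (1 + L) (x k)) * ‖ψ x‖ ^ 2)
        + ∑ k, (-(oneBodyConst C * Z * (1 + Real.log (1 + L) ^ 2)) * ‖ψ x‖ ^ 2
          - Z * C * (1 + L) * pd k (fun x => arsinhDiff (1 + L) (x k) * ‖ψ x‖ ^ 2) x)
        - ∑ k, (Z * L * (weight (1 + L) (x k) * ‖pd k ψ x‖ ^ 2
          + x k / weight (1 + L) (x k) * (conj (ψ x) * pd k ψ x).re)
          - weight (1 + L) (x k) * (Z * v (x k)) * ‖ψ x‖ ^ 2)
        + ∑ _k : Fin (n + 1), oneBodyConst C * Z * (1 + Real.log (1 + L) ^ 2) * ‖ψ x‖ ^ 2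
        - (∑ k, weight (1 + L) (x k) * ∑ i : Fin n, w |x k - x (k.succAbove i)|) * ‖ψ x‖ ^ 2 := by
    rw [hpot]
    simp only [Finset.mul_sum (s := (Finset.univ : Finset (Fin (n + 1)))),
      Finset.sum_mul (s := (Finset.univ : Finset (Fin (n + 1)))), ← Finset.sum_add_distrib,
      ← Finset.sum_sub_distrib]
    refine Finset.sum_congr rfl fun k _ => ?_
    rw [reducedDensity]
    ring
  rw [hdiff, energyDensity, hnorm]
  rw [Finset.sum_const, Finset.card_univ, Fintype.card_fin, nsmul_eq_mul]
  push_cast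
  linarith

end Main

/-! ### Comparison of ground energies and the bound on `Nmax` -/

section Bound

variable {n : ℕ} {v w : ℝ → ℝ} {A D : ℝ}

lemma integrable_weight_mul_reducedDensity (hv : Measurable v) (hw : Measurable w)
    (hA : ∀ x, |v x| ≤ A) (hD : ∀ u, |w u| ≤ D) {R : ℝ} (hR : 0 < R) (Z K e : ℝ)
    {ψ : (Fin (n + 1) → ℝ) → ℂ} (hψ : ContDiff ℝ ∞ ψ) (hc : HasCompactSupport ψ)
    (k : Fin (n + 1)) :
    Integrable fun x => weight R (x k) * reducedDensity v w Z K e ψ k x := by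
  obtain ⟨B, hB⟩ := exists_abs_potential_le (n := n) hA hD Z
  have hg : Continuous fun x : Fin (n + 1) → ℝ => weight R (x k) :=
    (contDiff_weight hR).continuous.comp (continuous_apply k)
  have hcont {f : (Fin (n + 1) → ℝ) → ℂ} (hf : Continuous f) :
      Continuous fun x => weight R (x k) * ‖f x‖ ^ 2 := hg.mul (hf.norm.pow 2)
  have hcomp {f : (Fin (n + 1) → ℝ) → ℂ} (hf : HasCompactSupport f) :
      HasCompactSupport fun x => weight R (x k) * ‖f x‖ ^ 2 :=
    (hasCompactSupport_norm_sq hf).mul_left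
  have h1 : Integrable fun x => K * ∑ i : Fin n, weight R (x k) * ‖pd (k.succAbove i) ψ x‖ ^ 2 :=
    (integrable_finsetSum _ fun i _ =>
      (hcont (contDiff_pd hψ _).continuous).integrable_of_hasCompactSupport
        (hcomp (hasCompactSupport_pd (hψ.differentiable (by simp)) hc _))).const_mul _
  have h2 : Integrable fun x : Fin (n + 1) → ℝ =>
      potential v w Z (fun i => x (k.succAbove i)) * (weight R (x k) * ‖ψ x‖ ^ 2) :=
    integrable_mul_of_bounded ((measurable_potential hv hw Z).comp (by fun_prop))
      (fun x => hB _) (hcont hψ.continuous) (hcomp hc)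
  have h3 : Integrable fun x => e * (weight R (x k) * ‖ψ x‖ ^ 2) :=
    ((hcont hψ.continuous).integrable_of_hasCompactSupport (hcomp hc)).const_mul _
  refine ((h1.add h2).sub h3).congr (ae_of_all _ fun x => ?_)
  simp only [Pi.add_apply, Pi.sub_apply, reducedDensity, ← Finset.mul_sum]
  ring

/-- With `x_k = t` frozen, the weight is a positive constant and the rest is the `n`-electron energy
of the slice minus `e` times its squared norm; Fubini concludes. -/
lemma integral_weight_mul_reducedDensity_nonneg (hv : Measurable v) (hw : Measurable w)
    (hA : ∀ x, |v x| ≤ A) (hD : ∀ u, |w u| ≤ D) {R : ℝ} (hR : 0 < R) {Z M e : ℝ}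
    (he : (e : EReal) ≤ groundEnergy v w n Z M)
    {ψ : (Fin (n + 1) → ℝ) → ℂ} (hψ : ContDiff ℝ ∞ ψ) (hc : HasCompactSupport ψ)
    (k : Fin (n + 1)) :
    0 ≤ ∫ x, weight R (x k) * reducedDensity v w Z (1 / M) e ψ k x := by
  refine integral_nonneg_of_insertNth
    (integrable_weight_mul_reducedDensity hv hw hA hD hR Z (1 / M) e hψ hc k) k fun t => ?_
  have hs : ContDiff ℝ ∞ fun y : Fin n → ℝ => ψ (k.insertNth t y) :=
    hψ.comp (contDiff_insertNth k t)
  have hsc := hasCompactSupport_comp_insertNth hc k t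
  have h (y : Fin n → ℝ) : weight R ((k.insertNth t y : Fin (n + 1) → ℝ) k)
      * reducedDensity v w Z (1 / M) e ψ k (k.insertNth t y)
      = weight R t * (energyDensity v w Z (1 / M) (fun y => ψ (k.insertNth t y)) y
        - e * ‖ψ (k.insertNth t y)‖ ^ 2) := by
    simp only [reducedDensity, energyDensity, pd_insertNth, Fin.insertNth_apply_same,
      Fin.insertNth_apply_succAbove]
  simp_rw [h]
  rw [integral_const_mul, integral_sub (integrable_energyDensity hv hw hA hD _ _ hs hsc)
    ((integrable_norm_sq hs.continuous hsc).const_mul e), integral_const_mul]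
  exact mul_nonneg (weight_pos hR t).le
    (sub_nonneg.2 (mul_integral_norm_sq_le hv hw hA hD he hs hsc))

/-- Adding an electron to `n` electrons does not lower the energy if `n` is large. -/
lemma groundEnergy_le_succ {c C Z L M : ℝ} (hc : 0 ≤ c) (hw : IsRepulsion w c D) (hC : 0 ≤ C)
    (hvm : Measurable v) (hv0 : ∀ x, 0 ≤ v x) (hv : ∀ x, v x ≤ C / √(1 + x ^ 2)) (hZ : 0 < Z)
    (hL : 0 < L) (hM : 1 / M = Z * L)
    (hn : 4 * (oneBodyConst C * Z * (1 + Real.log (1 + L) ^ 2)) ≤ n * c) :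
    groundEnergy v w n Z M ≤ groundEnergy v w (n + 1) Z M := by
  have hA (x : ℝ) : |v x| ≤ C := by
    rw [abs_of_nonneg (hv0 x)]
    exact (hv x).trans (div_le_self hC (Real.one_le_sqrt.2 (by nlinarith [sq_nonneg x])))
  have hD (u : ℝ) : |w u| ≤ D := by
    rw [abs_of_nonneg (hw.nonneg u)]
    exact hw.le u
  have hwm := hw.measurable
  have hR : 0 < 1 + L := by linarith
  refine le_iInf₂ fun Φ hΦ => ?_
  rw [re_integral_hamiltonian hvm hwm hA hD Z M hΦ.smooth hΦ.compactSupport]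
  -- Testing against real `e` below the `n`-electron energy avoids having to know that this energy
  -- is finite.
  refine EReal.ge_of_forall_gt_iff_ge.1 fun e he => EReal.coe_le_coe_iff.2 ?_
  have hF := contDiff_sqrt_totalWeight (n := n) hR
  have hF0 (x : Fin (n + 1) → ℝ) : √(totalWeight (1 + L) x) ≠ 0 :=
    (Real.sqrt_pos.2 (totalWeight_pos hR x)).ne'
  set ψ : (Fin (n + 1) → ℝ) → ℂ :=
    fun x => (((√(totalWeight (1 + L) x))⁻¹ : ℝ) : ℂ) * Φ x with hψdef
  have hψ : ContDiff ℝ ∞ ψ := (Complex.ofRealCLM.contDiff.comp (hF.inv hF0)).mul hΦ.smooth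
  have hψc : HasCompactSupport ψ := hΦ.compactSupport.mul_left
  have hΦψ : (fun x => ((√(totalWeight (1 + L) x) : ℝ) : ℂ) * ψ x) = Φ := by
    funext x
    rw [hψdef, ← mul_assoc, ← Complex.ofReal_mul, mul_inv_cancel₀ (hF0 x), Complex.ofReal_one,
      one_mul]
  have hpt (x : Fin (n + 1) → ℝ) := energyDensity_ge hc hw hC hv hZ hL hn e
    (hψ.differentiable (by simp)) x
  simp only [congrFun hΦψ, ← hM] at hpt
  have hcur (k : Fin (n + 1)) : ContDiff ℝ ∞ fun x => arsinhDiff (1 + L) (x k) * ‖ψ x‖ ^ 2 :=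
    ((contDiff_arsinhDiff _).comp (contDiff_apply ℝ ℝ k)).mul (hψ.norm_sq ℝ)
  have hcurc (k : Fin (n + 1)) :
      HasCompactSupport fun x => arsinhDiff (1 + L) (x k) * ‖ψ x‖ ^ 2 :=
    (hasCompactSupport_norm_sq hψc).mul_left
  have hi1 := integrable_finsetSum Finset.univ fun k _ =>
    integrable_weight_mul_reducedDensity hvm hwm hA hD hR Z (1 / M) e hψ hψc k
  have hi2 (k : Fin (n + 1)) :=
    (contDiff_pd (hcur k) k).continuous.integrable_of_hasCompactSupport (μ := volume)
      (hasCompactSupport_pd ((hcur k).differentiable (by simp)) (hcurc k) k)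
  have hi3 := integrable_energyDensity hvm hwm hA hD Z (1 / M) hΦ.smooth hΦ.compactSupport
  have hi4 := (integrable_norm_sq hΦ.smooth.continuous hΦ.compactSupport).const_mul e
  have hmono := integral_mono
    (hi1.sub ((integrable_finsetSum Finset.univ fun k _ => hi2 k).const_mul (Z * C * (1 + L))))
    (hi3.sub hi4) hpt
  rw [integral_sub' hi1 ((integrable_finsetSum Finset.univ fun k _ => hi2 k).const_mul _),
    integral_sub' hi3 hi4, integral_const_mul, integral_const_mul, hΦ.normalized,
    integral_finsetSum _ fun k _ => integrable_weight_mul_reducedDensity hvm hwm hA hD hR Z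
      (1 / M) e hψ hψc k, integral_finsetSum _ fun k _ => hi2 k] at hmono
  simp only [integral_pd_eq_zero (hcur _) (hcurc _), Finset.sum_const_zero, mul_zero,
    sub_zero, mul_one] at hmono
  have hnn := Finset.sum_nonneg fun k (_ : k ∈ Finset.univ) =>
    integral_weight_mul_reducedDensity_nonneg hvm hwm hA hD hR he.le hψ hψc k
  linarith

/-- The maximal number of electrons is at most of order `Z (1 + log² (1 + √B / Z))`. -/
theorem exists_Nmax_le (m : ℕ) {c : ℝ} (hc : 0 < c) (hw : IsRepulsion w c D) :
    ∃ C : ℝ, 0 < C ∧ ∀ Z B : ℝ, 0 < Z → 0 < B →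
      Nmax (V m) w Z B ≤ ((1 + C * Z * (1 + Real.log (1 + √B / Z) ^ 2) : ℝ) : EReal) := by
  obtain ⟨C, hC, hv⟩ := exists_V_le m
  have hC' : 0 < oneBodyConst C := by unfold oneBodyConst; positivity
  refine ⟨4 * oneBodyConst C / c, by positivity, fun Z B hZ hB => ?_⟩
  refine iSup₂_le fun N hN => EReal.coe_le_coe_iff.2 ?_
  obtain ⟨hN1, hlt⟩ := hN
  obtain ⟨n, rfl⟩ := Nat.exists_eq_add_of_le' hN1
  by_contra! h
  refine absurd hlt (not_lt.2 ?_)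
  -- With `M = B^(-1/2)` the kinetic prefactor is `1 / M = √B = Z L`. The condition concerns `n = N
  -- - 1`, whence the additive 1 in the bound.
  refine groundEnergy_le_succ hc.le hw hC.le (measurable_V m) (V_nonneg m) hv hZ
    (L := √B / Z) (by positivity) ?_ ?_
  · rw [Real.rpow_neg hB.le, ← Real.sqrt_eq_rpow]
    field_simp
  · have h1 : 4 * oneBodyConst C / c * Z * (1 + Real.log (1 + √B / Z) ^ 2) ≤ n := by
      push_cast at h
      linarith
    calc _ = 4 * oneBodyConst C / c * Z * (1 + Real.log (1 + √B / Z) ^ 2) * c := by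
          field_simp
      _ ≤ n * c := by gcongr

end Bound

/-! ### The logarithm in the two regimes -/

lemma log_one_add_sqrt_div_le {Z B y : ℝ} (hZ : 1 ≤ Z) (hy : 0 ≤ y) (hB : B < Real.exp y) :
    Real.log (1 + √B / Z) ≤ 1 + y := by
  have h1 : √B ≤ Real.exp y := by
    rw [Real.sqrt_le_left (Real.exp_pos y).le]
    nlinarith [Real.one_le_exp hy]
  have h2 : √B / Z ≤ Real.exp y := (div_le_self (Real.sqrt_nonneg B) hZ).trans h1
  have h3 : 1 + √B / Z ≤ Real.exp (1 + y) := by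
    rw [Real.exp_add]
    nlinarith [Real.add_one_le_exp 1, Real.one_le_exp hy]
  have h4 : 0 < 1 + √B / Z := by positivity
  exact (Real.log_le_iff_le_exp h4).2 h3

/-- The factor 2 comes from `1 ≤ 2 log Z`, valid for `Z ≥ 2`, which absorbs the constant `log (1 +
√a)`. -/
lemma log_one_add_sqrt_mul_rpow_div_le {a p Z : ℝ} (ha : 0 < a) (hp : 3 < p) (hZ : 2 ≤ Z) :
    Real.log (1 + √(a * Z ^ p) / Z) ≤ (2 * Real.log (1 + √a) + p) * Real.log Z := by
  have hZ0 : 0 < Z := by linarith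
  have hlog : 1 / 2 ≤ Real.log Z := by
    have := Real.log_le_log two_pos hZ
    linarith [Real.log_two_gt_d9]
  have h1 : √(a * Z ^ p) / Z ≤ √a * Z ^ p := by
    have h2 : 1 ≤ Z ^ p := Real.one_le_rpow (by linarith) (by linarith)
    refine (div_le_self (Real.sqrt_nonneg _) (by linarith)).trans ?_
    rw [Real.sqrt_mul ha.le]
    gcongr
    rw [Real.sqrt_le_left (by positivity)]
    nlinarith
  have h2 : 1 + √(a * Z ^ p) / Z ≤ (1 + √a) * Z ^ p := by
    have h2 : 1 ≤ Z ^ p := Real.one_le_rpow (by linarith) (by linarith)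
    linarith
  have h3 : 0 < 1 + √(a * Z ^ p) / Z := by positivity
  have h4 : 0 ≤ Real.log (1 + √a) := Real.log_nonneg (by linarith [Real.sqrt_nonneg a])
  calc _ ≤ Real.log ((1 + √a) * Z ^ p) := Real.log_le_log h3 h2
    _ = Real.log (1 + √a) + p * Real.log Z := by
      rw [Real.log_mul (by positivity) (by positivity), Real.log_rpow hZ0]
    _ ≤ _ := by nlinarith

end LandauModel

end

theorem mainTheorem5 (m : ℕ) (w : ℝ → ℝ)
    (hw : w = LandauModel.W m m ∨ w = LandauModel.WLower m) :
    (∃ a₁ : ℝ, 0 < a₁ ∧ ∃ a₂ : ℝ, 0 < a₂ ∧ ∀ α : ℝ, 0 < α → ∃ A : ℝ, 0 < A ∧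
      ∀ ε : ℝ, 0 < ε → ∀ Z B : ℝ, 1 ≤ Z →
        B < a₁ * Real.exp (Z ^ (α / 4)) → a₂ * Z ^ (2 + ε) ≤ B →
          LandauModel.Nmax (LandauModel.V m) w Z B
            ≤ ((2 * Z + A * Z ^ (1 + α) : ℝ) : EReal)) ∧
    (∀ a p : ℝ, 0 < a → 3 < p → ∃ A : ℝ, 0 < A ∧ ∀ Z : ℝ, 2 ≤ Z →
      LandauModel.Nmax (LandauModel.V m) w Z (a * Z ^ p)
        ≤ ((3 * Z + A * Z * (Real.log Z) ^ 2 : ℝ) : EReal)) := by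
  obtain ⟨c, D, hc, hrep⟩ : ∃ c D : ℝ, 0 < c ∧ LandauModel.IsRepulsion w c D := by
    rcases hw with rfl | rfl
    · exact LandauModel.exists_isRepulsion_W m m
    · exact LandauModel.exists_isRepulsion_WLower m
  obtain ⟨C, hC, hN⟩ := LandauModel.exists_Nmax_le m hc hrep
  -- With `y = Z^(α/4) ≥ 1`, `1 + (1 + y)² ≤ 5 y⁴ = 5 Z^α`, which gives the 5; the additive 1 is
  -- absorbed by `2 Z`.
  refine ⟨⟨1, one_pos, 1, one_pos, fun α hα => ⟨5 * C, by positivity,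
    fun ε _ Z B hZ hB1 hB2 => ?_⟩⟩, fun a p ha hp => ?_⟩
  · have hZ0 : 0 < Z := by linarith
    have hB : 0 < B := lt_of_lt_of_le (by positivity) hB2
    refine (hN Z B hZ0 hB).trans (EReal.coe_le_coe_iff.2 ?_)
    set y := Z ^ (α / 4) with hy
    have hy1 : 1 ≤ y := Real.one_le_rpow hZ (by positivity)
    have hlog := LandauModel.log_one_add_sqrt_div_le hZ (by linarith) (by simpa using hB1)
    have hlog0 : 0 ≤ Real.log (1 + √B / Z) := Real.log_nonneg (by
      have : 0 ≤ √B / Z := by positivity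
      linarith)
    have hyZ : y ^ 4 = Z ^ α := by
      rw [hy, ← Real.rpow_natCast, ← Real.rpow_mul hZ0.le]
      congr 1
      push_cast
      ring
    have hy4 : y ^ 2 ≤ y ^ 4 := pow_le_pow_right₀ hy1 (by norm_num)
    have hl : 1 + Real.log (1 + √B / Z) ^ 2 ≤ 5 * Z ^ α := by
      rw [← hyZ]
      nlinarith
    have hfin : C * Z * (1 + Real.log (1 + √B / Z) ^ 2) ≤ C * Z * (5 * Z ^ α) := by gcongr
    rw [Real.rpow_add hZ0, Real.rpow_one]
    linarith
  · set q := 2 * Real.log (1 + √a) + p with hq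
    -- The 4 comes from `1 ≤ 4 log² Z`, and `q²` from squaring the bound on the logarithm.
    refine ⟨C * (4 + q ^ 2), by positivity, fun Z hZ => ?_⟩
    have hZ0 : 0 < Z := by linarith
    refine (hN Z _ hZ0 (by positivity)).trans (EReal.coe_le_coe_iff.2 ?_)
    have hlog := LandauModel.log_one_add_sqrt_mul_rpow_div_le ha hp hZ
    have hlog0 : 0 ≤ Real.log (1 + √(a * Z ^ p) / Z) := Real.log_nonneg (by
      have : 0 ≤ √(a * Z ^ p) / Z := by positivity
      linarith)
    have hZlog : 1 / 2 ≤ Real.log Z := by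
      have := Real.log_le_log two_pos hZ
      linarith [Real.log_two_gt_d9]
    have hl : 1 + Real.log (1 + √(a * Z ^ p) / Z) ^ 2 ≤ (4 + q ^ 2) * Real.log Z ^ 2 := by
      have := pow_le_pow_left₀ hlog0 hlog 2
      nlinarith
    have hfin : C * Z * (1 + Real.log (1 + √(a * Z ^ p) / Z) ^ 2)
        ≤ C * Z * ((4 + q ^ 2) * Real.log Z ^ 2) := by gcongr
    linarith
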